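/- Let $A_1,\dots,A_n$ be finitely many quantum systems with finite-dimensional state spaces $\mathbb C^{d_1},\dots,\mathbb C^{d_n}$, and let $S\subseteq\{1,\dots,n\}$ be the set of systems that are measured (in particular, $S=\{1,\dots,n\}$ is allowed). For a density operator $\rho$ on $\bigotimes_{k=1}^n\mathbb C^{d_k}$ write $\rho_{A_k}$ for its reduced density operator on $A_k$. Given, for each $k\in S$, an orthonormal eigenbasis $\{|i_k\rangle\}$ of $\rho_{A_k}$, with $\Pi_{i_k}=|i_k\rangle\langle i_k|$, put $$\pi(\rho)=\sum_{(i_k)_{k\in S}} P_{(i_k)}\,\rho\,P_{(i_k)},\qquad P_{(i_k)}=\bigotimes_{k\in S}\Pi_{i_k}\otimes\bigotimes_{k\notin S} I_{A_k}.$$ For a distance measure $\delta$, the multi-sided diagonal discord is $$\bar{\mathfrak D}_{\delta,S}(\rho)=\inf_{\pi}\ \delta(\rho,\pi(\rho)),$$ where the infimum is over the choices of the local eigenbases. (When $\rho_{A_k}$ is nondegenerate, that is, has only simple eigenvalues, for every $k\in S$, the state $\pi(\rho)$ does not depend on the choice, and $\bar{\mathfrak D}_{\delta,S}(\rho)=\delta(\rho,\pi(\rho))$.)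 Let $\delta$ be either the Schatten distance $\delta(\rho,\sigma)=\|\rho-\sigma\|_p$, $1\le p\le\infty$, where $\|X\|_p$ is the $\ell^p$ norm of the singular values of $X$, or the relative entropy $\delta(\rho,\sigma)=S(\rho\|\sigma)$, which equals $\operatorname{tr}\rho(\log\rho-\log\sigma)$ if $\operatorname{supp}\rho\subseteq\operatorname{supp}\sigma$ and $+\infty$ otherwise. If $\rho_0$ is a density operator such that $(\rho_0)_{A_k}$ is nondegenerate for every $k\in S$, then $\bar{\mathfrak D}_{\delta,S}(\rho_0)$ is finite and $\bar{\mathfrak D}_{\delta,S}$, as a function on the set of all density operators on $\bigotimes_{k=1}^n\mathbb C^{d_k}$ with values in $[-\infty,\infty]$, is continuous at $\rho_0$. -/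

import Mathlib

namespace MultiDiscord

open scoped Matrix ENNReal ComplexOrder

noncomputable section

/-- The density matrices on `ℂ^m`: positive semidefinite matrices of trace one. As a subtype of the
matrices it carries the usual (norm) topology. -/
def densityMatrices (m : Type*) [Fintype m] : Set (Matrix m m ℂ) :=
  {ρ | ρ.PosSemidef ∧ ρ.trace = 1}

/-- The singular values of a square matrix: the square roots of the eigenvalues of `Aᴴ * A`. -/
def singularValue {m : Type*} [Fintype m] [DecidableEq m] (A : Matrix m m ℂ) (i : m) : ℝ :=
  √((Matrix.isHermitian_conjTranspose_mul_self A).eigenvalues i)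

/-- The Schatten `p`-norm: the `ℓ^p` norm of the family of singular values. -/
def schattenNorm {m : Type*} [Fintype m] [DecidableEq m] (p : ℝ≥0∞) (A : Matrix m m ℂ) : ℝ :=
  ‖(WithLp.toLp p (singularValue A) : PiLp p (fun _ : m => ℝ))‖

/-- The distance `‖ρ - σ‖_p` given by the Schatten `p`-norm. -/
def schattenDist {m : Type*} [Fintype m] [DecidableEq m] (p : ℝ≥0∞)
    (ρ σ : Matrix m m ℂ) : EReal :=
  (schattenNorm p (ρ - σ) : ℝ)

open Classical in
/-- The quantum relative entropy `S(ρ‖σ) = tr (ρ (log ρ - log σ))`, which is `+∞` unless the support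
of `ρ` is contained in that of `σ` (that is, `ker σ ⊆ ker ρ`). With `Real.log 0 = 0`, the functional
calculus gives the logarithm on the support, extended by zero to the kernel. -/
def relativeEntropy {m : Type*} [Fintype m] [DecidableEq m] (ρ σ : Matrix m m ℂ) : EReal :=
  if ∀ v : m → ℂ, σ *ᵥ v = 0 → ρ *ᵥ v = 0 then
    (((ρ * (cfc Real.log ρ - cfc Real.log σ)).trace.re : ℝ) : EReal)
  else ⊤

/-- A Hermitian matrix is nondegenerate if all its eigenvalues are simple. -/
def Nondegenerate {m : Type*} [Fintype m] [DecidableEq m] (A : Matrix m m ℂ) : Prop :=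
  ∀ μ : ℂ, Module.finrank ℂ (Module.End.eigenspace (Matrix.toEuclideanLin A) μ) ≤ 1

/-- The orthonormal basis `e` consists of eigenvectors of `A`. -/
def IsEigenbasis {m : Type*} [Fintype m] [DecidableEq m] (A : Matrix m m ℂ)
    (e : OrthonormalBasis m ℂ (EuclideanSpace ℂ m)) : Prop :=
  ∀ i, ∃ μ : ℂ, Module.End.HasEigenvector (Matrix.toEuclideanLin A) μ (e i)

/-- The rank-one projector `|v⟩⟨v|`. -/
def ketBra {m : Type*} (v : EuclideanSpace ℂ m) : Matrix m m ℂ :=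
  Matrix.of fun a b => v a * star (v b)

section Composite

variable {ι : Type*} [Fintype ι] [DecidableEq ι] {α : ι → Type*}
  [∀ k, Fintype (α k)] [∀ k, DecidableEq (α k)]

/-- The tensor product `⨂ k, M k`, acting on `⨂ k, ℂ^(α k) = ℂ^(Π k, α k)`. -/
def tensorProd (M : ∀ k, Matrix (α k) (α k) ℂ) : Matrix (∀ k, α k) (∀ k, α k) ℂ :=
  Matrix.of fun x y => ∏ k, M k (x k) (y k)

/-- The local density matrix of the `k`-th system: the partial trace over all the others. The index
`Function.update x k b` agrees with `x` except that its `k`-th entry is `b`. -/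
def marginal (ρ : Matrix (∀ k, α k) (∀ k, α k) ℂ) (k : ι) : Matrix (α k) (α k) ℂ :=
  Matrix.of fun a b => ∑ x with x k = a, ρ x (Function.update x k b)

/-- The operator which is the projector `|e k (i k)⟩⟨e k (i k)|` on each measured system `k ∈ S`,
and the identity on the systems that are not measured. -/
def measurementProj (S : Finset ι)
    (e : ∀ k : S, OrthonormalBasis (α k) ℂ (EuclideanSpace ℂ (α k)))
    (i : ∀ k : S, α k) : Matrix (∀ k, α k) (∀ k, α k) ℂ :=
  tensorProd fun k => if h : k ∈ S then ketBra (e ⟨k, h⟩ (i ⟨k, h⟩)) else 1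

/-- The state after the (nonselective) local measurements in the bases `e k`, `k ∈ S`. -/
def measuredState (S : Finset ι)
    (e : ∀ k : S, OrthonormalBasis (α k) ℂ (EuclideanSpace ℂ (α k)))
    (ρ : Matrix (∀ k, α k) (∀ k, α k) ℂ) : Matrix (∀ k, α k) (∀ k, α k) ℂ :=
  ∑ i : (∀ k : S, α k), measurementProj S e i * ρ * measurementProj S e i

/-- The multi-sided diagonal discord of `ρ`, as measured on the systems in `S` and given by `δ`: the
value `δ (ρ, π ρ)`, where `π` is the local measurement in eigenbases of the local density matrices.
It is minimized over the eigenbases; the measured state does not depend on their choice when the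
measured local density matrices are nondegenerate. -/
def diagonalDiscord
    (δ : Matrix (∀ k, α k) (∀ k, α k) ℂ → Matrix (∀ k, α k) (∀ k, α k) ℂ → EReal)
    (S : Finset ι) (ρ : Matrix (∀ k, α k) (∀ k, α k) ℂ) : EReal :=
  ⨅ (e : ∀ k : S, OrthonormalBasis (α k) ℂ (EuclideanSpace ℂ (α k)))
    (_ : ∀ k : S, IsEigenbasis (marginal ρ k) (e k)), δ ρ (measuredState S e ρ)

end Composite

end

end MultiDiscord

namespace MultiDiscord

open scoped Matrix ENNReal ComplexOrder Topology

section MatrixAnalysis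

variable {m : Type*} [Fintype m] [DecidableEq m]

lemma trace_cfc {A : Matrix m m ℂ} (hA : A.IsHermitian) (f : ℝ → ℝ) :
    (cfc f A).trace = ∑ i, (f (hA.eigenvalues i) : ℂ) := by
  rw [hA.cfc_eq, Matrix.IsHermitian.cfc, Unitary.conjStarAlgAut_apply, Matrix.trace_mul_comm,
    ← mul_assoc, Unitary.coe_star_mul_self, one_mul, Matrix.trace_diagonal]
  rfl

lemma continuous_re_trace_cfc {f : ℝ → ℝ} (hf : Continuous f) :
    Continuous fun A : {A : Matrix m m ℂ // IsSelfAdjoint A} => (cfc f A.1).trace.re := by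
  have h : Continuous fun A : {A : Matrix m m ℂ // IsSelfAdjoint A} => cfc f A.1 := by
    open scoped Matrix.Norms.L2Operator in
    exact Continuous.cfc_of_mem_nhdsSet (s := Set.univ) f Filter.univ_mem continuous_subtype_val
      (fun A => A.2) hf.continuousOn
  exact Complex.continuous_re.comp h.matrix_trace

open scoped Matrix.Norms.L2Operator in
lemma norm_eigenvalues {A : Matrix m m ℂ} (hA : A.IsHermitian) : ‖hA.eigenvalues‖ = ‖A‖ := by
  conv_rhs => rw [hA.spectral_theorem]
  rw [Unitary.conjStarAlgAut_apply, ← Unitary.coe_star, CStarRing.norm_mul_coe_unitary,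
    CStarRing.norm_coe_unitary_mul, Matrix.l2_opNorm_diagonal]
  simp [Pi.norm_def]

open scoped Matrix.Norms.L2Operator in
lemma schattenNorm_top (A : Matrix m m ℂ) : schattenNorm ∞ A = ‖A‖ := by
  have hnn : ∀ i, 0 ≤ (Matrix.isHermitian_conjTranspose_mul_self A).eigenvalues i :=
    (Matrix.posSemidef_conjTranspose_mul_self A).eigenvalues_nonneg
  have h1 : schattenNorm ∞ A = ‖singularValue A‖ := by
    rw [schattenNorm, PiLp.norm_toLp]
  have h2 : singularValue A * star (singularValue A) =
      (Matrix.isHermitian_conjTranspose_mul_self A).eigenvalues := by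
    ext i
    simp [singularValue, Real.mul_self_sqrt (hnn i)]
  have h3 := CStarRing.norm_self_mul_star (x := singularValue A)
  rw [h2, norm_eigenvalues, Matrix.l2_opNorm_conjTranspose_mul_self] at h3
  rw [h1]
  exact ((mul_self_inj (norm_nonneg _) (norm_nonneg _)).1 h3).symm

lemma schattenNorm_of_ne_top {p : ℝ≥0∞} (hp : 1 ≤ p) (hp' : p ≠ ∞) (A : Matrix m m ℂ) :
    schattenNorm p A = (cfc (fun x : ℝ => √x ^ p.toReal) (Aᴴ * A)).trace.re ^ (1 / p.toReal) := by
  have h0 : 0 < p.toReal := ENNReal.toReal_pos (by positivity) hp'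
  rw [schattenNorm, PiLp.norm_eq_sum h0, trace_cfc (Matrix.isHermitian_conjTranspose_mul_self A),
    ← Complex.ofReal_sum, Complex.ofReal_re]
  simp [singularValue, abs_of_nonneg (Real.sqrt_nonneg _)]

lemma continuous_schattenNorm {p : ℝ≥0∞} (hp : 1 ≤ p) :
    Continuous (schattenNorm p : Matrix m m ℂ → ℝ) := by
  by_cases hp' : p = ∞
  · subst hp'
    open scoped Matrix.Norms.L2Operator in
    exact continuous_norm.congr fun A : Matrix m m ℂ => (schattenNorm_top A).symm
  · have h0 : 0 < p.toReal := ENNReal.toReal_pos (by positivity) hp'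
    rw [funext (schattenNorm_of_ne_top hp hp')]
    have hf : Continuous fun x : ℝ => √x ^ p.toReal :=
      Real.continuous_sqrt.rpow_const fun _ => Or.inr h0.le
    have hA : Continuous fun A : Matrix m m ℂ =>
        (⟨Aᴴ * A, Matrix.isHermitian_conjTranspose_mul_self A⟩ :
          {A : Matrix m m ℂ // IsSelfAdjoint A}) :=
      Continuous.subtype_mk (continuous_id.matrix_conjTranspose.matrix_mul continuous_id) _
    exact ((continuous_re_trace_cfc hf).comp hA).rpow_const fun _ => Or.inr (by positivity)

/-- The von Neumann entropy up to sign, `tr (A log A)`. -/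
noncomputable def traceMulLog (A : Matrix m m ℂ) : ℝ :=
  (cfc (fun x : ℝ => x * Real.log x) A).trace.re

lemma continuous_traceMulLog :
    Continuous fun A : {A : Matrix m m ℂ // IsSelfAdjoint A} => traceMulLog A.1 :=
  continuous_re_trace_cfc Real.continuous_mul_log

lemma mul_cfc_log {A : Matrix m m ℂ} (hA : IsSelfAdjoint A) :
    A * cfc Real.log A = cfc (fun x : ℝ => x * Real.log x) A := by
  have hfin : (spectrum ℝ A).Finite := by
    rw [Matrix.IsHermitian.spectrum_real_eq_range_eigenvalues hA]
    exact Set.finite_range _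
  rw [cfc_mul (fun x : ℝ => x) Real.log A continuousOn_id (hfin.continuousOn _), cfc_id' ℝ A]

section Pinching

variable {κ : Type*} [Fintype κ] {P : κ → Matrix m m ℂ}

lemma mul_pinching [DecidableEq κ] (hP : ∀ i j, P i * P j = if i = j then P i else 0) (ρ : Matrix m m ℂ) (j : κ) :
    P j * ∑ i, P i * ρ * P i = P j * ρ * P j := by
  simp [Finset.mul_sum, ← mul_assoc, hP]

lemma pinching_mul [DecidableEq κ] (hP : ∀ i j, P i * P j = if i = j then P i else 0) (ρ : Matrix m m ℂ) (j : κ) :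
    (∑ i, P i * ρ * P i) * P j = P j * ρ * P j := by
  simp [Finset.sum_mul, mul_assoc, hP]

omit [DecidableEq m] in
lemma isSelfAdjoint_pinching (hPh : ∀ i, (P i).IsHermitian) {ρ : Matrix m m ℂ}
    (hρ : ρ.IsHermitian) : IsSelfAdjoint (∑ i, P i * ρ * P i) := by
  simp [IsSelfAdjoint, Matrix.star_eq_conjTranspose, Matrix.conjTranspose_mul, (hPh _).eq, hρ.eq, mul_assoc]

lemma trace_mul_cfc_pinching [DecidableEq κ] (hP : ∀ i j, P i * P j = if i = j then P i else 0)
    (hP1 : ∑ i, P i = 1) (ρ : Matrix m m ℂ) (f : ℝ → ℝ) :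
    (ρ * cfc f (∑ i, P i * ρ * P i)).trace =
      ((∑ i, P i * ρ * P i) * cfc f (∑ i, P i * ρ * P i)).trace := by
  set σ := ∑ i, P i * ρ * P i with hσ
  have hc : ∀ j, cfc f σ * P j = P j * cfc f σ := fun j =>
    (Commute.cfc_real (show Commute σ (P j) from
      (pinching_mul hP ρ j).trans (mul_pinching hP ρ j).symm) f)
  have h1 : (ρ * cfc f σ).trace = ∑ i, (P i * (ρ * cfc f σ)).trace := by
    rw [← Matrix.trace_sum, ← Finset.sum_mul, hP1, one_mul]
  have h2 : (σ * cfc f σ).trace = ∑ i, (P i * ρ * P i * cfc f σ).trace := by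
    rw [← Matrix.trace_sum, ← Finset.sum_mul]
  rw [h1, h2]
  refine Finset.sum_congr rfl fun i _ => ?_
  have h3 : P i = P i * P i := by simp [hP]
  calc (P i * (ρ * cfc f σ)).trace = (P i * (P i * (ρ * cfc f σ))).trace := by
        rw [← mul_assoc (P i) (P i), ← h3]
    _ = (P i * ρ * (cfc f σ * P i)).trace := by
        rw [Matrix.trace_mul_comm]; simp only [mul_assoc]
    _ = _ := by rw [hc]; simp only [mul_assoc]

lemma mulVec_eq_zero_of_pinching (hPh : ∀ i, (P i).IsHermitian) (hP1 : ∑ i, P i = 1)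
    {ρ : Matrix m m ℂ} (hρ : ρ.PosSemidef) {v : m → ℂ}
    (hv : (∑ i, P i * ρ * P i) *ᵥ v = 0) : ρ *ᵥ v = 0 := by
  have h1 : ∀ i, star v ⬝ᵥ (P i * ρ * P i) *ᵥ v = star (P i *ᵥ v) ⬝ᵥ ρ *ᵥ (P i *ᵥ v) := by
    intro i
    rw [Matrix.star_mulVec, (hPh i).eq, ← Matrix.dotProduct_mulVec]
    simp only [Matrix.mulVec_mulVec, mul_assoc]
  have h2 : ∑ i, star (P i *ᵥ v) ⬝ᵥ ρ *ᵥ (P i *ᵥ v) = 0 := by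
    simp_rw [← h1]
    rw [← dotProduct_sum, ← Matrix.sum_mulVec, hv, dotProduct_zero]
  have h3 : ∀ i, ρ *ᵥ (P i *ᵥ v) = 0 := fun i =>
    (hρ.dotProduct_mulVec_zero_iff _).1
      ((Finset.sum_eq_zero_iff_of_nonneg fun i _ => hρ.dotProduct_mulVec_nonneg _).1 h2 i
        (Finset.mem_univ i))
  calc ρ *ᵥ v = ρ *ᵥ ((∑ i, P i) *ᵥ v) := by rw [hP1, Matrix.one_mulVec]
    _ = ∑ i, ρ *ᵥ (P i *ᵥ v) := by rw [Matrix.sum_mulVec, Matrix.mulVec_sum]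
    _ = 0 := Finset.sum_eq_zero fun i _ => h3 i

/-- The relative entropy to a pinching is the increase in entropy. -/
lemma relativeEntropy_pinching [DecidableEq κ] (hP : ∀ i j, P i * P j = if i = j then P i else 0)
    (hPh : ∀ i, (P i).IsHermitian) (hP1 : ∑ i, P i = 1) {ρ : Matrix m m ℂ} (hρ : ρ.PosSemidef) :
    relativeEntropy ρ (∑ i, P i * ρ * P i) =
      ((traceMulLog ρ - traceMulLog (∑ i, P i * ρ * P i) : ℝ) : EReal) := by
  rw [relativeEntropy, if_pos fun v => mulVec_eq_zero_of_pinching hPh hP1 hρ, mul_sub,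
    Matrix.trace_sub, trace_mul_cfc_pinching hP hP1, mul_cfc_log hρ.1,
    mul_cfc_log (isSelfAdjoint_pinching hPh hρ.1), Complex.sub_re]
  rfl

end Pinching

end MatrixAnalysis

section Vectors

variable {m : Type*}

lemma ketBra_isHermitian (v : EuclideanSpace ℂ m) : (ketBra v).IsHermitian := by
  ext a b
  simp [ketBra, mul_comm]

variable [Fintype m]

lemma ketBra_mul_ketBra (v w : EuclideanSpace ℂ m) :
    ketBra v * ketBra w = inner ℂ v w • (Matrix.of fun a b => v a * star (w b)) := by
  ext a b
  simp only [ketBra, Matrix.mul_apply, Matrix.of_apply, Matrix.smul_apply, PiLp.inner_apply,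
    smul_eq_mul, Finset.sum_mul]
  refine Finset.sum_congr rfl fun c _ => ?_
  simp only [RCLike.inner_apply, starRingEnd_apply]
  ring

omit [Fintype m] in
lemma ketBra_smul {c : ℂ} (hc : ‖c‖ = 1) (v : EuclideanSpace ℂ m) :
    ketBra (c • v) = ketBra v := by
  have h : c * star c = 1 := by
    rw [RCLike.star_def, Complex.mul_conj, Complex.normSq_eq_norm_sq, hc]
    simp
  ext a b
  simp only [ketBra, Matrix.of_apply, PiLp.smul_apply, smul_eq_mul, star_mul']
  linear_combination (v a * star (v b)) * h

variable [DecidableEq m]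

lemma ketBra_basis_mul (e : OrthonormalBasis m ℂ (EuclideanSpace ℂ m)) (i j : m) :
    ketBra (e i) * ketBra (e j) = if i = j then ketBra (e i) else 0 := by
  rw [ketBra_mul_ketBra, e.inner_eq_ite]
  split_ifs with h
  · subst h
    rw [one_smul]
    rfl
  · rw [zero_smul]

lemma sum_ketBra_basis (e : OrthonormalBasis m ℂ (EuclideanSpace ℂ m)) :
    ∑ i, ketBra (e i) = 1 := by
  ext a b
  have h := congrArg (fun x : EuclideanSpace ℂ m => x a) (e.sum_repr' (EuclideanSpace.single b 1))
  simp only [EuclideanSpace.inner_single_right, one_mul] at h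
  simp only [Matrix.sum_apply, ketBra, Matrix.of_apply, Matrix.one_apply]
  simp only [WithLp.ofLp_sum, WithLp.ofLp_smul, Finset.sum_apply, Pi.smul_apply, smul_eq_mul,
    PiLp.single_apply] at h
  rw [← h]
  exact Finset.sum_congr rfl fun i _ => mul_comm _ _

/-- Two orthonormal eigenbases of a nondegenerate Hermitian matrix have the same projectors. -/
lemma exists_perm_ketBra_eq {A : Matrix m m ℂ} (hA : A.IsHermitian) (hn : Nondegenerate A)
    {e e' : OrthonormalBasis m ℂ (EuclideanSpace ℂ m)} (he : IsEigenbasis A e)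
    (he' : IsEigenbasis A e') :
    ∃ σ : Equiv.Perm m, ∀ i, ketBra (e' (σ i)) = ketBra (e i) := by
  have hsymm : (Matrix.toEuclideanLin A).IsSymmetric := Matrix.isSymmetric_toEuclideanLin_iff.2 hA
  have key : ∀ i, ∃ j, ∃ c : ℂ, e' j = c • e i := by
    intro i
    obtain ⟨j, hj⟩ : ∃ j, inner ℂ (e' j) (e i) ≠ 0 := by
      by_contra! h
      have h0 := e'.sum_repr' (e i)
      simp only [h, zero_smul, Finset.sum_const_zero] at h0
      exact e.orthonormal.ne_zero i h0.symm
    obtain ⟨μ, hμ⟩ := he i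
    obtain ⟨ν, hν⟩ := he' j
    have hμν : ν = μ := by
      by_contra hne
      exact hj (hsymm.orthogonalFamily_eigenspaces hne ⟨e' j, hν.1⟩ ⟨e i, hμ.1⟩)
    subst hμν
    obtain ⟨c, hc⟩ := (finrank_le_one_iff.1 (hn ν))
    obtain ⟨a, ha⟩ := hc ⟨e i, hμ.1⟩
    obtain ⟨b, hb⟩ := hc ⟨e' j, hν.1⟩
    have ha' : a • (c : EuclideanSpace ℂ m) = e i := congrArg Subtype.val ha
    have hb' : b • (c : EuclideanSpace ℂ m) = e' j := congrArg Subtype.val hb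
    have ha0 : a ≠ 0 := by
      rintro rfl
      exact e.orthonormal.ne_zero i (by rw [← ha', zero_smul])
    refine ⟨j, b * a⁻¹, ?_⟩
    rw [← ha', ← hb', smul_smul, mul_assoc, inv_mul_cancel₀ ha0, mul_one]
  choose s c hs using key
  have hc : ∀ i, ‖c i‖ = 1 := by
    intro i
    have h := congrArg norm (hs i)
    rw [norm_smul, e.orthonormal.1, e'.orthonormal.1, mul_one] at h
    exact h.symm
  have hinj : Function.Injective s := by
    intro i j hij
    by_contra hne
    have h : c i • e i = c j • e j := by rw [← hs, ← hs, hij]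
    have h2 := congrArg (inner ℂ (e i)) h
    rw [inner_smul_right, inner_smul_right, e.inner_eq_ite, e.inner_eq_ite, if_pos rfl,
      if_neg hne, mul_one, mul_zero] at h2
    simpa [h2] using hc i
  refine ⟨Equiv.ofBijective s (Finite.injective_iff_bijective.1 hinj), fun i => ?_⟩
  rw [Equiv.ofBijective_apply, hs, ketBra_smul (hc i)]

lemma exists_isEigenbasis {A : Matrix m m ℂ} (hA : A.IsHermitian) :
    ∃ e, IsEigenbasis A e := by
  refine ⟨hA.eigenvectorBasis, fun i => ⟨(hA.eigenvalues i : ℂ), ?_⟩⟩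
  refine ⟨Module.End.mem_eigenspace_iff.2 ?_, hA.eigenvectorBasis.orthonormal.ne_zero i⟩
  apply WithLp.ofLp_injective
  have h := hA.mulVec_eigenvectorBasis i
  simp only [Matrix.toLpLin_apply]
  rw [h]
  ext
  simp

lemma isEigenbasis_iff {A : Matrix m m ℂ} {e : OrthonormalBasis m ℂ (EuclideanSpace ℂ m)} :
    IsEigenbasis A e ↔ ∀ i, Matrix.toEuclideanLin A (e i) =
      (inner ℂ (e i) (Matrix.toEuclideanLin A (e i)) : ℂ) • e i := by
  refine forall_congr' fun i => ⟨?_, fun h => ⟨_, Module.End.mem_eigenspace_iff.2 h,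
    e.orthonormal.ne_zero i⟩⟩
  rintro ⟨μ, hμ⟩
  have h := Module.End.mem_eigenspace_iff.1 hμ.1
  rw [h, inner_smul_right, e.inner_eq_ite, if_pos rfl, mul_one]

end Vectors

section Composite

variable {ι : Type*} [Fintype ι] [DecidableEq ι] {α : ι → Type*}
  [∀ k, Fintype (α k)] [∀ k, DecidableEq (α k)]

omit [DecidableEq ι] [∀ k, Fintype (α k)] [∀ k, DecidableEq (α k)] in
lemma tensorProd_isHermitian {M : ∀ k, Matrix (α k) (α k) ℂ} (hM : ∀ k, (M k).IsHermitian) :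
    (tensorProd M).IsHermitian := by
  ext x y
  simp only [tensorProd, Matrix.conjTranspose_apply, Matrix.of_apply, star_prod]
  exact Finset.prod_congr rfl fun k _ => (hM k).apply _ _

omit [∀ k, DecidableEq (α k)] in
lemma tensorProd_mul (M N : ∀ k, Matrix (α k) (α k) ℂ) :
    tensorProd M * tensorProd N = tensorProd fun k => M k * N k := by
  ext x y
  simp only [tensorProd, Matrix.mul_apply, Matrix.of_apply, ← Finset.prod_mul_distrib]
  exact (Fintype.prod_sum fun k z => M k (x k) z * N k z (y k)).symm

omit [DecidableEq ι] [∀ k, Fintype (α k)] in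
lemma tensorProd_one : tensorProd (fun k => (1 : Matrix (α k) (α k) ℂ)) = 1 := by
  classical
  ext x y
  simp only [tensorProd, Matrix.of_apply, Matrix.one_apply, Finset.prod_ite_zero,
    Finset.prod_const_one, Finset.mem_univ, true_imp_iff, funext_iff]

variable (S : Finset ι) (e : ∀ k : S, OrthonormalBasis (α k) ℂ (EuclideanSpace ℂ (α k)))

lemma measurementProj_isHermitian (i : ∀ k : S, α k) : (measurementProj S e i).IsHermitian := by
  refine tensorProd_isHermitian fun k => ?_
  split_ifs
  · exact ketBra_isHermitian _
  · exact Matrix.isHermitian_one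

lemma measurementProj_mul (i j : ∀ k : S, α k) :
    measurementProj S e i * measurementProj S e j = if i = j then measurementProj S e i else 0 := by
  rw [measurementProj, measurementProj, tensorProd_mul]
  split_ifs with h
  · subst h
    congr 1
    funext k
    split_ifs
    · rw [ketBra_basis_mul, if_pos rfl]
    · rw [one_mul]
  · obtain ⟨k, hk⟩ := Function.ne_iff.1 h
    ext x y
    refine Finset.prod_eq_zero (Finset.mem_univ k.1) ?_
    simp [ketBra_basis_mul, hk]

lemma sum_measurementProj : ∑ i, measurementProj S e i = 1 := by
  rw [← tensorProd_one]
  ext x y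
  have h : ∀ (i : ∀ k : S, α k), measurementProj S e i x y =
      (∏ k : S, ketBra (e k (i k)) (x k) (y k)) *
        ∏ k ∈ Finset.univ with k ∉ S, (1 : Matrix (α k) (α k) ℂ) (x k) (y k) := by
    intro i
    simp only [measurementProj, tensorProd, Matrix.of_apply]
    rw [← Finset.prod_filter_mul_prod_filter_not Finset.univ (· ∈ S)]
    congr 1
    · rw [Finset.filter_univ_mem, ← Finset.prod_coe_sort]
      exact Finset.prod_congr rfl fun k _ => by rw [dif_pos k.2]
    · exact Finset.prod_congr rfl fun k hk => by rw [dif_neg (Finset.mem_filter.1 hk).2]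
  rw [Matrix.sum_apply]
  simp_rw [h]
  rw [← Finset.sum_mul, ← Fintype.prod_sum fun (k : S) j => ketBra (e k j) (x k) (y k)]
  simp_rw [← Matrix.sum_apply, sum_ketBra_basis]
  rw [Finset.prod_coe_sort S fun k => (1 : Matrix (α k) (α k) ℂ) (x k) (y k)]
  have h1 := Finset.prod_filter_mul_prod_filter_not Finset.univ (· ∈ S)
    fun k => (1 : Matrix (α k) (α k) ℂ) (x k) (y k)
  rwa [Finset.filter_univ_mem] at h1

variable {S e}

lemma measuredState_eq_of_perm {e' : ∀ k : S, OrthonormalBasis (α k) ℂ (EuclideanSpace ℂ (α k))}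
    (h : ∀ k : S, ∃ σ : Equiv.Perm (α k), ∀ i, ketBra (e' k (σ i)) = ketBra (e k i))
    (ρ : Matrix (∀ k, α k) (∀ k, α k) ℂ) : measuredState S e' ρ = measuredState S e ρ := by
  choose σ hσ using h
  rw [measuredState, measuredState, ← Equiv.sum_comp (Equiv.piCongrRight σ)]
  have h : ∀ i, measurementProj S e' (Equiv.piCongrRight σ i) = measurementProj S e i := by
    intro i
    simp only [measurementProj, Equiv.piCongrRight_apply, Pi.map_apply, hσ]
  simp only [h]

lemma marginal_isHermitian {ρ : Matrix (∀ k, α k) (∀ k, α k) ℂ} (hρ : ρ.IsHermitian) (k : ι) :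
    (marginal ρ k).IsHermitian := by
  ext a b
  simp only [marginal, Matrix.conjTranspose_apply, Matrix.of_apply, star_sum, hρ.apply]
  refine Finset.sum_bij' (fun x _ => Function.update x k a) (fun x _ => Function.update x k b)
    ?_ ?_ ?_ ?_ ?_
  · simp
  · simp
  · intro x hx
    simp [← (Finset.mem_filter.1 hx).2]
  · intro x hx
    simp [← (Finset.mem_filter.1 hx).2]
  · intro x hx
    simp [← (Finset.mem_filter.1 hx).2]

end Composite

/-- An infimum over the fibers of a closed relation with compact range is continuous at a point over
which the function is constant. -/
lemma continuousAt_iInf_fiber {X V E : Type*} [TopologicalSpace X] [TopologicalSpace V]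
    {φ : E → V} (hφ : IsCompact (Set.range φ)) {R : X → V → Prop}
    (hR : IsClosed {z : X × V | R z.1 z.2}) {F : X × V → ℝ} (hF : Continuous F) {x₀ : X} {c : ℝ}
    (hc : ∀ e, R x₀ (φ e) → F (x₀, φ e) = c) (hex : ∀ x, ∃ e, R x (φ e)) :
    (⨅ (e) (_ : R x₀ (φ e)), (F (x₀, φ e) : EReal)) = c ∧
      ContinuousAt (fun x => ⨅ (e) (_ : R x (φ e)), (F (x, φ e) : EReal)) x₀ := by
  have hval : (⨅ (e) (_ : R x₀ (φ e)), (F (x₀, φ e) : EReal)) = c := by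
    obtain ⟨e, he⟩ := hex x₀
    refine le_antisymm ((iInf₂_le e he).trans_eq (by rw [hc e he])) ?_
    exact le_iInf₂ fun e he => by rw [hc e he]
  have key : ∀ U : Set ℝ, IsOpen U → c ∈ U →
      ∀ᶠ x in 𝓝 x₀, ∀ v ∈ Set.range φ, R x v → F (x, v) ∈ U := by
    intro U hU hcU
    refine hφ.eventually_forall_of_forall_eventually ?_
    rintro _ ⟨e, rfl⟩
    by_cases he : R x₀ (φ e)
    · have h := hF.continuousAt.eventually_mem (x := (x₀, φ e))
        (hU.mem_nhds (by rw [hc e he]; exact hcU))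
      exact h.mono fun z hz _ => hz
    · have h := hR.isOpen_compl.mem_nhds (x := (x₀, φ e)) he
      exact Filter.mem_of_superset h fun z hz hz' => absurd hz' hz
  refine ⟨hval, ?_⟩
  rw [ContinuousAt, hval, tendsto_order]
  constructor
  · intro a ha
    obtain ⟨b, hab, hbc⟩ := EReal.lt_iff_exists_real_btwn.1 ha
    filter_upwards [key _ isOpen_Ioi (EReal.coe_lt_coe_iff.1 hbc)] with x hx
    exact hab.trans_le (le_iInf₂ fun e he => EReal.coe_le_coe (le_of_lt (hx _ ⟨e, rfl⟩ he)))
  · intro a ha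
    obtain ⟨b, hcb, hba⟩ := EReal.lt_iff_exists_real_btwn.1 ha
    filter_upwards [key _ isOpen_Iio (EReal.coe_lt_coe_iff.1 hcb)] with x hx
    obtain ⟨e, he⟩ := hex x
    exact (iInf₂_le e he).trans_lt ((EReal.coe_lt_coe (hx _ ⟨e, rfl⟩ he)).trans hba)

lemma isCompact_setOf_orthonormal (m : Type*) [Fintype m] [DecidableEq m] :
    IsCompact {v : m → EuclideanSpace ℂ m | Orthonormal ℂ v} := by
  refine (isCompact_univ_pi fun _ : m => isCompact_sphere (0 : EuclideanSpace ℂ m) 1).of_isClosed_subset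
    ?_ fun v hv i _ => by simpa using hv.1 i
  simp only [orthonormal_iff_ite, Set.ofPred_forall]
  refine isClosed_iInter fun i => isClosed_iInter fun j => ?_
  exact isClosed_eq ((continuous_apply i).inner (continuous_apply j)) continuous_const

lemma exists_orthonormalBasis_eq {m : Type*} [Fintype m] {v : m → EuclideanSpace ℂ m}
    (hv : Orthonormal ℂ v) : ∃ e : OrthonormalBasis m ℂ (EuclideanSpace ℂ m), ⇑e = v :=
  ⟨OrthonormalBasis.mk hv
    (hv.linearIndependent.span_eq_top_of_card_eq_finrank' (by simp)).ge, by simp⟩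

section Composite

variable {ι : Type*} [Fintype ι] [DecidableEq ι] {α : ι → Type*}
  [∀ k, Fintype (α k)] [∀ k, DecidableEq (α k)]

/-- The families of vectors underlying the families of local orthonormal bases. -/
noncomputable def basisVectors (S : Finset ι)
    (e : ∀ k : S, OrthonormalBasis (α k) ℂ (EuclideanSpace ℂ (α k))) :
    ∀ k : S, α k → EuclideanSpace ℂ (α k) :=
  fun k => e k

omit [Fintype ι] [DecidableEq ι] in
lemma isCompact_range_basisVectors (S : Finset ι) :
    IsCompact (Set.range (basisVectors (α := α) S)) := by
  have h : Set.range (basisVectors (α := α) S) =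
      Set.univ.pi fun k : S => {v : α k → EuclideanSpace ℂ (α k) | Orthonormal ℂ v} := by
    ext v
    constructor
    · rintro ⟨e, rfl⟩ k -
      exact (e k).orthonormal
    · intro hv
      choose e he using fun k : S => exists_orthonormalBasis_eq (hv k trivial)
      exact ⟨e, funext he⟩
  rw [h]
  exact isCompact_univ_pi fun k => isCompact_setOf_orthonormal _

/-- The operator `∑ i, T i * ρ * T i`, where `T i` is the tensor product of the operators
`|v k (i k)⟩⟨v k (i k)|`, `k ∈ S`, and of the identities on the other systems. -/
noncomputable def vectorMeasuredState (S : Finset ι) (v : ∀ k : S, α k → EuclideanSpace ℂ (α k))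
    (ρ : Matrix (∀ k, α k) (∀ k, α k) ℂ) : Matrix (∀ k, α k) (∀ k, α k) ℂ :=
  ∑ i : (∀ k : S, α k),
    (tensorProd fun k => if h : k ∈ S then ketBra (v ⟨k, h⟩ (i ⟨k, h⟩)) else 1) * ρ *
      (tensorProd fun k => if h : k ∈ S then ketBra (v ⟨k, h⟩ (i ⟨k, h⟩)) else 1)

lemma isSelfAdjoint_vectorMeasuredState (S : Finset ι)
    (v : ∀ k : S, α k → EuclideanSpace ℂ (α k)) {ρ : Matrix (∀ k, α k) (∀ k, α k) ℂ}
    (hρ : ρ.IsHermitian) : IsSelfAdjoint (vectorMeasuredState S v ρ) := by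
  refine isSelfAdjoint_pinching (fun i => tensorProd_isHermitian fun k => ?_) hρ
  split_ifs
  · exact ketBra_isHermitian _
  · exact Matrix.isHermitian_one

lemma continuous_vectorMeasuredState (S : Finset ι) :
    Continuous fun z : Matrix (∀ k, α k) (∀ k, α k) ℂ × (∀ k : S, α k → EuclideanSpace ℂ (α k)) =>
      vectorMeasuredState S z.2 z.1 := by
  refine continuous_finsetSum _ fun i _ => ?_
  have h : Continuous fun z : Matrix (∀ k, α k) (∀ k, α k) ℂ ×
      (∀ k : S, α k → EuclideanSpace ℂ (α k)) => (tensorProd fun k =>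
        if h : k ∈ S then ketBra (z.2 ⟨k, h⟩ (i ⟨k, h⟩)) else (1 : Matrix (α k) (α k) ℂ)) := by
    refine continuous_matrix fun x y => continuous_finsetProd _ fun k _ => ?_
    by_cases hk : k ∈ S
    · simp only [dif_pos hk, ketBra, Matrix.of_apply]
      fun_prop
    · simp only [dif_neg hk]
      exact continuous_const
  exact (h.matrix_mul continuous_fst).matrix_mul h

/-- The vectors `v k i` are eigenvectors of the local density matrices of `ρ`, provided that they
are unit vectors. -/
def IsLocalEigenfamily (S : Finset ι) (ρ : Matrix (∀ k, α k) (∀ k, α k) ℂ)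
    (v : ∀ k : S, α k → EuclideanSpace ℂ (α k)) : Prop :=
  ∀ (k : S) (i : α k), Matrix.toEuclideanLin (marginal ρ k) (v k i) =
    (inner ℂ (v k i) (Matrix.toEuclideanLin (marginal ρ k) (v k i)) : ℂ) • v k i

lemma isLocalEigenfamily_basisVectors {S : Finset ι} {ρ : Matrix (∀ k, α k) (∀ k, α k) ℂ}
    {e : ∀ k : S, OrthonormalBasis (α k) ℂ (EuclideanSpace ℂ (α k))} :
    IsLocalEigenfamily S ρ (basisVectors S e) ↔ ∀ k : S, IsEigenbasis (marginal ρ k) (e k) :=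
  forall_congr' fun _ => isEigenbasis_iff.symm

lemma isClosed_setOf_isLocalEigenfamily (S : Finset ι) :
    IsClosed {z : Matrix (∀ k, α k) (∀ k, α k) ℂ × (∀ k : S, α k → EuclideanSpace ℂ (α k)) |
      IsLocalEigenfamily S z.1 z.2} := by
  simp only [IsLocalEigenfamily, Set.ofPred_forall]
  refine isClosed_iInter fun k => isClosed_iInter fun i => ?_
  have hv : Continuous fun z : Matrix (∀ k, α k) (∀ k, α k) ℂ ×
      (∀ k : S, α k → EuclideanSpace ℂ (α k)) => z.2 k i := by fun_prop
  have hm : Continuous fun z : Matrix (∀ k, α k) (∀ k, α k) ℂ ×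
      (∀ k : S, α k → EuclideanSpace ℂ (α k)) => marginal z.1 k := by
    refine continuous_matrix fun a b => continuous_finsetSum _ fun x _ => ?_
    exact continuous_fst.matrix_elem _ _
  have hL : Continuous fun z : Matrix (∀ k, α k) (∀ k, α k) ℂ ×
      (∀ k : S, α k → EuclideanSpace ℂ (α k)) =>
        Matrix.toEuclideanLin (marginal z.1 k) (z.2 k i) :=
    (PiLp.continuous_toLp 2 _).comp (hm.matrix_mulVec ((PiLp.continuous_ofLp 2 _).comp hv))
  have hi : Continuous fun z : Matrix (∀ k, α k) (∀ k, α k) ℂ ×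
      (∀ k : S, α k → EuclideanSpace ℂ (α k)) =>
        (inner ℂ (z.2 k i) (Matrix.toEuclideanLin (marginal z.1 k) (z.2 k i)) : ℂ) := hv.inner hL
  exact isClosed_eq hL (hi.smul hv)

/-- Continuity of the diagonal discord of any distance measure that is a continuous function of the
state and the measurement bases. -/
lemma diagonalDiscord_continuousAt (S : Finset ι) (ρ₀ : densityMatrices (∀ k, α k))
    (hρ₀ : ∀ k ∈ S, Nondegenerate (marginal ρ₀.1 k))
    {δ : Matrix (∀ k, α k) (∀ k, α k) ℂ → Matrix (∀ k, α k) (∀ k, α k) ℂ → EReal}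
    {F : densityMatrices (∀ k, α k) × (∀ k : S, α k → EuclideanSpace ℂ (α k)) → ℝ}
    (hF : Continuous F)
    (hδ : ∀ (ρ : densityMatrices (∀ k, α k)) e,
      δ ρ.1 (measuredState S e ρ.1) = F (ρ, basisVectors S e)) :
    (diagonalDiscord δ S ρ₀.1 ≠ ⊥ ∧ diagonalDiscord δ S ρ₀.1 ≠ ⊤) ∧
      ContinuousAt (fun ρ : densityMatrices (∀ k, α k) => diagonalDiscord δ S ρ.1) ρ₀ := by
  have hD : (fun ρ : densityMatrices (∀ k, α k) => diagonalDiscord δ S ρ.1) = fun ρ =>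
      ⨅ (e) (_ : IsLocalEigenfamily S ρ.1 (basisVectors S e)), (F (ρ, basisVectors S e) : EReal) := by
    funext ρ
    simp only [diagonalDiscord, hδ, isLocalEigenfamily_basisVectors]
  have hex : ∀ ρ : densityMatrices (∀ k, α k),
      ∃ e, IsLocalEigenfamily S ρ.1 (basisVectors S e) := by
    intro ρ
    choose e he using fun k : S => exists_isEigenbasis (marginal_isHermitian ρ.2.1.1 k)
    exact ⟨e, isLocalEigenfamily_basisVectors.2 he⟩
  have hR : IsClosed {z : densityMatrices (∀ k, α k) × (∀ k : S, α k → EuclideanSpace ℂ (α k)) |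
      IsLocalEigenfamily S z.1.1 z.2} :=
    (isClosed_setOf_isLocalEigenfamily S).preimage (continuous_subtype_val.prodMap continuous_id)
  obtain ⟨e₀, he₀⟩ := hex ρ₀
  have hc : ∀ e, IsLocalEigenfamily S ρ₀.1 (basisVectors S e) →
      F (ρ₀, basisVectors S e) = F (ρ₀, basisVectors S e₀) := by
    intro e he
    rw [isLocalEigenfamily_basisVectors] at he he₀
    have h := measuredState_eq_of_perm (fun k : S => exists_perm_ketBra_eq
      (marginal_isHermitian ρ₀.2.1.1 k) (hρ₀ k k.2) (he₀ k) (he k)) ρ₀.1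
    exact EReal.coe_injective (by rw [← hδ, ← hδ, h])
  obtain ⟨hval, hcont⟩ := continuousAt_iInf_fiber (isCompact_range_basisVectors S)
    (R := fun ρ : densityMatrices (∀ k, α k) => IsLocalEigenfamily S ρ.1) hR hF hc hex
  have hval' : diagonalDiscord δ S ρ₀.1 = (F (ρ₀, basisVectors S e₀) : EReal) :=
    (congrFun hD ρ₀).trans hval
  rw [hD, hval']
  exact ⟨⟨EReal.coe_ne_bot _, EReal.coe_ne_top _⟩, hcont⟩

lemma continuous_measuredState_densityMatrices (S : Finset ι) :
    Continuous fun z : densityMatrices (∀ k, α k) ×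
      (∀ k : S, α k → EuclideanSpace ℂ (α k)) => vectorMeasuredState S z.2 z.1.1 := by
  have h : Continuous fun z : densityMatrices (∀ k, α k) ×
      (∀ k : S, α k → EuclideanSpace ℂ (α k)) => (z.1.1, z.2) :=
    (continuous_subtype_val.comp continuous_fst).prodMk continuous_snd
  have hcomp := (continuous_vectorMeasuredState S).comp h
  exact hcomp

theorem diagonalDiscord_schattenDist_continuousAt (S : Finset ι) (ρ₀ : densityMatrices (∀ k, α k))
    (hρ₀ : ∀ k ∈ S, Nondegenerate (marginal ρ₀.1 k)) {p : ℝ≥0∞} (hp : 1 ≤ p) :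
    (diagonalDiscord (schattenDist p) S ρ₀.1 ≠ ⊥ ∧ diagonalDiscord (schattenDist p) S ρ₀.1 ≠ ⊤) ∧
      ContinuousAt (fun ρ : densityMatrices (∀ k, α k) =>
        diagonalDiscord (schattenDist p) S ρ.1) ρ₀ := by
  have h : Continuous fun z : densityMatrices (∀ k, α k) ×
      (∀ k : S, α k → EuclideanSpace ℂ (α k)) => z.1.1 - vectorMeasuredState S z.2 z.1.1 :=
    (continuous_subtype_val.comp continuous_fst).sub (continuous_measuredState_densityMatrices S)
  exact diagonalDiscord_continuousAt S ρ₀ hρ₀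
    (F := fun z => schattenNorm p (z.1.1 - vectorMeasuredState S z.2 z.1.1))
    ((continuous_schattenNorm hp).comp h) fun _ _ => rfl

theorem diagonalDiscord_relativeEntropy_continuousAt (S : Finset ι)
    (ρ₀ : densityMatrices (∀ k, α k)) (hρ₀ : ∀ k ∈ S, Nondegenerate (marginal ρ₀.1 k)) :
    (diagonalDiscord relativeEntropy S ρ₀.1 ≠ ⊥ ∧ diagonalDiscord relativeEntropy S ρ₀.1 ≠ ⊤) ∧
      ContinuousAt (fun ρ : densityMatrices (∀ k, α k) =>
        diagonalDiscord relativeEntropy S ρ.1) ρ₀ :=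
  diagonalDiscord_continuousAt S ρ₀ hρ₀
    (F := fun z => traceMulLog z.1.1 - traceMulLog (vectorMeasuredState S z.2 z.1.1))
    ((continuous_traceMulLog.comp
      ((continuous_subtype_val.comp continuous_fst).subtype_mk fun z => z.1.2.1.1)).sub
      (continuous_traceMulLog.comp ((continuous_measuredState_densityMatrices S).subtype_mk
        fun z => isSelfAdjoint_vectorMeasuredState S z.2 z.1.2.1.1)))
    fun ρ e => relativeEntropy_pinching (measurementProj_mul S e)
      (measurementProj_isHermitian S e) (sum_measurementProj S e) ρ.2.1

end Composite

end MultiDiscord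

theorem mainTheorem10 (n : ℕ) (d : Fin n → ℕ) (S : Finset (Fin n))
    (ρ₀ : MultiDiscord.densityMatrices (∀ k, Fin (d k)))
    (hρ₀ : ∀ k ∈ S, MultiDiscord.Nondegenerate (MultiDiscord.marginal ρ₀.1 k))
    (δ : Matrix (∀ k, Fin (d k)) (∀ k, Fin (d k)) ℂ →
      Matrix (∀ k, Fin (d k)) (∀ k, Fin (d k)) ℂ → EReal)
    (hδ : (∃ p : ENNReal, 1 ≤ p ∧ δ = MultiDiscord.schattenDist p) ∨
      δ = MultiDiscord.relativeEntropy) :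
    (MultiDiscord.diagonalDiscord δ S ρ₀.1 ≠ ⊥ ∧ MultiDiscord.diagonalDiscord δ S ρ₀.1 ≠ ⊤) ∧
      ContinuousAt (fun ρ : MultiDiscord.densityMatrices (∀ k, Fin (d k)) =>
        MultiDiscord.diagonalDiscord δ S ρ.1) ρ₀ := by
  rcases hδ with ⟨p, hp, rfl⟩ | rfl
  · exact MultiDiscord.diagonalDiscord_schattenDist_continuousAt S ρ₀ hρ₀ hp
  · exact MultiDiscord.diagonalDiscord_relativeEntropy_continuousAt S ρ₀ hρ₀
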